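/- For a positive integer $n$ let $\sigma_1(n)=\sum_{d\mid n} d$, and put $\sigma_1(0)=\tfrac12\zeta(-1)=-\tfrac1{24}$ and $\sigma_1(n)=0$ for $n<0$. Let $D\in\mathbb{N}$ be a non-square discriminant, i.e. $D\equiv 0$ or $1 \pmod 4$ and $D$ is not a perfect square. In the sums below $e$ runs over all integers satisfying the stated condition (only finitely many terms are nonzero). (i) If $D\equiv 0 \pmod 4$, then $$\sum_{e^2\equiv D\ (\mathrm{mod}\ 8)}\sigma_1\Big(\frac{D-e^2}{8}\Big)=\frac15\sum_{e\ \mathrm{even}}\sigma_1\Big(\frac{D-e^2}{4}\Big)+\frac45\sum_{e^2\equiv D/4\ (\mathrm{mod}\ 4)}\sigma_1\Big(\frac{D/4-e^2}{4}\Big).$$ (ii) If $D\equiv 1 \pmod 8$, then $$\sum_{e\ \mathrm{odd}}\sigma_1\Big(\frac{D-e^2}{8}\Big)=\frac25\sum_{e\ \mathrm{odd}}\sigma_1\Big(\frac{D-e^2}{4}\Big).$$ -/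

import Mathlib

/-- The divisor sum `σ₁`, extended to all integers by the convention
`σ₁(0) = ζ(-1) / 2 = -1/24` and `σ₁(n) = 0` for `n < 0`. -/
def sigmaOne (n : ℤ) : ℚ :=
  if 0 < n then (ArithmeticFunction.sigma 1 n.toNat : ℚ)
  else if n = 0 then -1 / 24
  else 0

/-- The value at `0` is half the value of the Riemann zeta function at `-1`. -/
theorem sigmaOne_zero : ((sigmaOne 0 : ℚ) : ℂ) = riemannZeta (-1) / 2 := by
  have h := riemannZeta_neg_nat_eq_bernoulli 1
  have h2 : bernoulli 2 = 1 / 6 := by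
    rw [bernoulli_eq_bernoulli'_of_ne_one (by norm_num), bernoulli'_two]
  norm_num [h2] at h
  rw [h]
  norm_num [sigmaOne]

/-- The sums over all integers `e` in the theorem have only finitely many nonzero terms. -/
theorem finite_support_sigmaOne (a m : ℤ) (hm : 0 < m) :
    (Function.support fun e : ℤ => sigmaOne ((a - e ^ 2) / m)).Finite := by
  refine (Set.finite_Icc (-|a|) |a|).subset fun e he => ?_
  by_contra hne
  apply he
  have hlt : a - e ^ 2 < 0 := by
    have h1 : |a| < |e| := by
      by_contra hle
      exact hne (Set.mem_Icc.2 (abs_le.1 (not_lt.1 hle)))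
    have h2 := le_abs_self a
    have h3 := abs_nonneg a
    have h4 := sq_abs e
    nlinarith
  have hneg : (a - e ^ 2) / m < 0 := Int.ediv_neg_of_neg_of_pos hlt hm
  have h5 : ¬ 0 < (a - e ^ 2) / m := by omega
  have h6 : (a - e ^ 2) / m ≠ 0 := by omega
  simp only [sigmaOne, if_neg h5, if_neg h6]

/-!
Since `D` is not a square, `σ₁(0)` never occurs, and each of the two identities is the comparison of
one coefficient in the logarithmic derivative, with respect to `X * d/dX`, of a product formula of
Gauss:

* `∑ (-1) ^ e * X ^ (e ^ 2) = ∏ (1 - X ^ r) / (1 + X ^ r)`, the sum over all integers `e`,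
* `∑ X ^ (s * (s + 1) / 2) = ∏ (1 - X ^ (2 * r)) / (1 - X ^ (2 * r - 1))`, the sum over `0 ≤ s`.

The logarithmic derivative of the first product is `-2 * ∑ σ'(n) * X ^ n`, where `σ'(n)` is the sum
of the divisors of `n` with odd codivisor (`sumOddCodivisor`); that of the second is
`∑ σ''(n) * X ^ n`, where `σ''(n)` is the sum of the odd divisors minus the sum of the even ones
(`altDivisorSum`). The operator `X * d/dX` introduces no new exponents into the series on the left,
so its coefficient at `N` vanishes when `N` is not a square, or not triangular. This gives
`∑ (-1) ^ e * σ'(N - e ^ 2) = 0` (`sum_sumOddCodivisor_sub_sq`) and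
`∑ σ''(N - j * (j + 1) / 2) = 0` (`sum_altDivisorSum_sub_triangular`).

The theorem follows with `D = 4 * N` and `D = 8 * N + 1`, because term by term
`5 σ₁(k / 2) - σ₁(k) - 4 σ₁(k / 4) = (-1) ^ k * σ'(k)` (`sigmaOne_combination`) and
`2 σ₁(2 * k) - 5 σ₁(k) = σ''(k)` (`sigmaOne_sub_sigmaOne_two_mul`).

Infinite products are avoided: Gauss' formulas enter through finite forms due to Shanks, which are
proved by telescoping and agree with the infinite ones modulo a high power of `X`.
-/

/-! ### Finite forms of Gauss' identities -/

/-- The finite form of Gauss' product for triangular numbers. The summand `s = 0` on the right is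
`∏ (1 - x ^ (2 * r + 2)) / (1 - x ^ (2 * r + 1))` over `r < n`; the others are divisible by
`x ^ (2 * n + 1)`. -/
theorem gauss_triangular_finite {R : Type*} [CommRing R] (x : R) (i : ℕ → R)
    (hi : ∀ r, (1 - x ^ (2 * r + 1)) * i r = 1) (n : ℕ) :
    ∑ s ∈ Finset.range (2 * n), x ^ (s * (s + 1) / 2) =
      ∑ s ∈ Finset.range n,
        (∏ r ∈ Finset.Ico s n, (1 - x ^ (2 * r + 2)) * i r) * x ^ (s * (2 * n + 1)) := by
  induction n with
  | zero => simp
  | succ n ih =>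
    set Q : ℕ → R := fun s => ∏ r ∈ Finset.Ico s n, (1 - x ^ (2 * r + 2)) * i r with hQ
    have hQs : ∀ s < n, Q s = (1 - x ^ (2 * s + 2)) * i s * Q (s + 1) := fun s hs =>
      Finset.prod_eq_prod_Ico_succ_bot hs _
    -- The summand at `s` for `n + 1` minus the one for `n` is a difference of consecutive values
    -- in `s`, so partial sums of these differences have a closed form.
    have key : ∀ t ≤ n, ∑ s ∈ Finset.range t,
        (Q s * ((1 - x ^ (2 * n + 2)) * i n) * x ^ (s * (2 * (n + 1) + 1))
          - Q s * x ^ (s * (2 * n + 1))) =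
        i n * x ^ (t * (2 * n + 1)) * Q t * (1 - x ^ (2 * t)) := by
      intro t
      induction t with
      | zero => simp
      | succ t iht =>
        intro ht
        rw [Finset.sum_range_succ, iht (by omega), hQs t (by omega)]
        have e1 : x ^ (t * (2 * (n + 1) + 1)) = x ^ (t * (2 * n + 1)) * x ^ (2 * t) := by
          rw [← pow_add]; congr 1; ring
        have e2 : x ^ ((t + 1) * (2 * n + 1)) = x ^ (t * (2 * n + 1)) * x ^ (2 * n + 1) := by
          rw [← pow_add]; congr 1; ring
        have e3 : x ^ (2 * (t + 1)) = x ^ (2 * t + 2) := rfl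
        rw [e1, e2, e3]
        have h1 := hi t
        have h2 := hi n
        set y := x ^ (t * (2 * n + 1))
        set q := Q (t + 1)
        linear_combination (x ^ (2 * n + 1) * i n * y * q * (1 - x ^ (2 * t + 2))) * h1
          + ((1 - x ^ (2 * t + 2)) * i t * q * y) * h2
    have hsplit : ∀ s ∈ Finset.range n,
        (∏ r ∈ Finset.Ico s (n + 1), (1 - x ^ (2 * r + 2)) * i r) * x ^ (s * (2 * (n + 1) + 1)) =
          Q s * ((1 - x ^ (2 * n + 2)) * i n) * x ^ (s * (2 * (n + 1) + 1)) := fun s hs => by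
      rw [Finset.prod_Ico_succ_top (Finset.mem_range.1 hs).le]
    have k := key n le_rfl
    rw [Finset.sum_sub_distrib, ← ih] at k
    rw [Finset.sum_range_succ _ n, Finset.sum_congr rfl hsplit,
      Nat.Ico_succ_singleton, Finset.prod_singleton,
      show 2 * (n + 1) = 2 * n + 1 + 1 by ring, Finset.sum_range_succ, Finset.sum_range_succ]
    rw [show 2 * n + 1 + 1 = 2 * (n + 1) by ring]
    have f1 : 2 * n * (2 * n + 1) / 2 = n * (2 * n + 1) := by
      rw [mul_assoc, Nat.mul_div_cancel_left _ (by norm_num)]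
    have f2 : (2 * n + 1) * (2 * (n + 1)) / 2 = n * (2 * n + 1) + (2 * n + 1) := by
      rw [show (2 * n + 1) * (2 * (n + 1)) = 2 * (n * (2 * n + 1) + (2 * n + 1)) by ring,
        Nat.mul_div_cancel_left _ (by norm_num)]
    have f3 : x ^ (n * (2 * (n + 1) + 1)) = x ^ (n * (2 * n + 1)) * x ^ (2 * n) := by
      rw [← pow_add]; congr 1; ring
    have hQn : Q n = 1 := by simp [hQ]
    rw [f1, f2, f3, pow_add x _ (2 * n + 1)]
    rw [hQn] at k
    have h2 := hi n
    set y := x ^ (n * (2 * n + 1))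
    linear_combination -k + (- y * (1 + x ^ (2 * n + 1))) * h2

/-- The finite form of Gauss' product for squares. As `2 * i 0 = 1`, the summand `s = 0` on the right
is `∏ (1 - x ^ (r + 1)) / (1 + x ^ (r + 1))` over `r < n`; the others are divisible by
`x ^ (n + 1)`. -/
theorem gauss_square_finite {R : Type*} [CommRing R] (x : R) (i : ℕ → R)
    (hi : ∀ r, (1 + x ^ r) * i r = 1) (n : ℕ) :
    1 + 2 * ∑ s ∈ Finset.range n, (-1) ^ (s + 1) * x ^ ((s + 1) ^ 2) =
      ∑ s ∈ Finset.range (n + 1),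
        2 * i s * (-1) ^ s * x ^ (s * (n + 1)) *
          ∏ r ∈ Finset.Ico s n, (1 - x ^ (r + 1)) * i (r + 1) := by
  induction n with
  | zero =>
    have := hi 0
    simp at this ⊢
    linear_combination -this
  | succ n ih =>
    set Q : ℕ → R := fun s => ∏ r ∈ Finset.Ico s n, (1 - x ^ (r + 1)) * i (r + 1) with hQ
    have hQs : ∀ s < n, Q s = (1 - x ^ (s + 1)) * i (s + 1) * Q (s + 1) := fun s hs =>
      Finset.prod_eq_prod_Ico_succ_bot hs _
    -- Partial sums of the differences between the summands for `n + 1` and for `n` telescope.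
    have key : ∀ t ≤ n, ∑ s ∈ Finset.range (t + 1),
        (2 * i s * (-1) ^ s * x ^ (s * (n + 1 + 1)) * (Q s * ((1 - x ^ (n + 1)) * i (n + 1)))
          - 2 * i s * (-1) ^ s * x ^ (s * (n + 1)) * Q s) =
        2 * i (n + 1) * (-1) ^ (t + 1) * x ^ ((t + 1) * (n + 1)) * Q t := by
      intro t
      induction t with
      | zero =>
        intro _
        have h0 := hi 0
        have h2 := hi (n + 1)
        simp only [pow_zero, zero_add, Finset.sum_range_one, zero_mul, mul_one, one_mul, pow_one]
          at h0 ⊢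
        linear_combination (2 * i 0 * Q 0) * h2 - 2 * i (n + 1) * x ^ (n + 1) * Q 0 * h0
      | succ t iht =>
        intro ht
        rw [Finset.sum_range_succ, iht (by omega), hQs t (by omega)]
        have e1 : x ^ ((t + 1) * (n + 1 + 1)) = x ^ ((t + 1) * (n + 1)) * x ^ (t + 1) := by
          rw [← pow_add]; congr 1
        have e2 : x ^ ((t + 1 + 1) * (n + 1)) = x ^ ((t + 1) * (n + 1)) * x ^ (n + 1) := by
          rw [← pow_add]; congr 1; ring
        rw [e1, e2, pow_succ (-1 : R) (t + 1)]
        have h1 := hi (t + 1)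
        have h2 := hi (n + 1)
        set y := x ^ ((t + 1) * (n + 1))
        set q := Q (t + 1)
        set ε := (-1 : R) ^ (t + 1)
        linear_combination (2 * i (t + 1) * ε * y * q) * h2
          - (2 * i (n + 1) * ε * y * q * x ^ (n + 1)) * h1
    have hsplit : ∀ s ∈ Finset.range (n + 1),
        2 * i s * (-1) ^ s * x ^ (s * (n + 1 + 1)) *
            ∏ r ∈ Finset.Ico s (n + 1), (1 - x ^ (r + 1)) * i (r + 1) =
          2 * i s * (-1) ^ s * x ^ (s * (n + 1 + 1)) *
            (Q s * ((1 - x ^ (n + 1)) * i (n + 1))) := fun s hs => by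
      rw [Finset.prod_Ico_succ_top (Nat.lt_succ_iff.1 (Finset.mem_range.1 hs))]
    have k := key n le_rfl
    rw [Finset.sum_sub_distrib, ← ih] at k
    rw [Finset.sum_range_succ _ (n + 1), Finset.sum_congr rfl hsplit,
      Finset.Ico_self, Finset.prod_empty, Finset.sum_range_succ _ n]
    have f3 : x ^ ((n + 1) * (n + 1 + 1)) = x ^ ((n + 1) ^ 2) * x ^ (n + 1) := by
      rw [← pow_add]; congr 1; ring
    have hQn : Q n = 1 := by simp [hQ]
    rw [hQn, ← sq] at k
    rw [f3]
    have h2 := hi (n + 1)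
    set y := x ^ ((n + 1) ^ 2)
    linear_combination -k - (2 * (-1) ^ (n + 1) * y) * h2

section PowerSeries

open PowerSeries

/-! ### Logarithmic derivatives of power series -/

/-- The geometric series `1 / (1 - X ^ k) = 1 + X ^ k + X ^ (2 * k) + ⋯`, for `0 < k`. -/
noncomputable def geomSeries (k : ℕ) : ℚ⟦X⟧ := PowerSeries.mk fun m => if k ∣ m then 1 else 0

theorem one_sub_X_pow_mul_geomSeries {k : ℕ} (hk : 0 < k) :
    (1 - X ^ k) * geomSeries k = 1 := by
  ext m
  rw [sub_mul, one_mul, map_sub, coeff_X_pow_mul', geomSeries, coeff_mk, coeff_mk, coeff_one]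
  by_cases hkm : k ≤ m
  · have : k ∣ m - k ↔ k ∣ m := Nat.dvd_sub_iff_left hkm dvd_rfl
    simp [hkm, this, show m ≠ 0 by omega]
  · rcases Nat.eq_zero_or_pos m with rfl | hm
    · simp [hk.ne']
    · have : ¬ k ∣ m := fun h => hkm (Nat.le_of_dvd hm h)
      simp [hkm, hm.ne', this]

/-- `X ^ k / (1 - X ^ k)`, for `0 < k`. -/
noncomputable def lambertTerm (k : ℕ) : ℚ⟦X⟧ := X ^ k * geomSeries k

theorem coeff_lambertTerm (k m : ℕ) :
    coeff m (lambertTerm k) = if k ≤ m ∧ k ∣ m then 1 else 0 := by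
  rw [lambertTerm, coeff_X_pow_mul', geomSeries, coeff_mk]
  by_cases hkm : k ≤ m
  · simp [hkm, Nat.dvd_sub_iff_left hkm dvd_rfl]
  · simp [hkm]

/-- `g` is the logarithmic derivative of `f` with respect to `X * d/dX`. -/
def HasLogDeriv (f g : ℚ⟦X⟧) : Prop := X * d⁄dX ℚ f = f * g

theorem HasLogDeriv.mul {f₁ f₂ g₁ g₂ : ℚ⟦X⟧} (h₁ : HasLogDeriv f₁ g₁) (h₂ : HasLogDeriv f₂ g₂) :
    HasLogDeriv (f₁ * f₂) (g₁ + g₂) := by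
  unfold HasLogDeriv at *
  rw [Derivation.leibniz, smul_eq_mul, smul_eq_mul]
  linear_combination f₁ * h₂ + f₂ * h₁

theorem HasLogDeriv.prod {f g : ℕ → ℚ⟦X⟧} (n : ℕ) (h : ∀ r, HasLogDeriv (f r) (g r)) :
    HasLogDeriv (∏ r ∈ Finset.Ico 0 n, f r) (∑ r ∈ Finset.range n, g r) := by
  rw [← Finset.range_eq_Ico]
  induction n with
  | zero => simp [HasLogDeriv]
  | succ n ih => rw [Finset.prod_range_succ, Finset.sum_range_succ]; exact ih.mul (h n)

theorem hasLogDeriv_one_sub_X_pow {k : ℕ} (hk : 0 < k) :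
    HasLogDeriv (1 - X ^ k) (-(k : ℚ) • lambertTerm k) := by
  have h : (X : ℚ⟦X⟧) * d⁄dX ℚ (X ^ k : ℚ⟦X⟧) = (k : ℚ) • X ^ k := by
    ext m
    cases m with
    | zero => simp [coeff_X_pow, hk.ne]
    | succ m =>
      rw [coeff_succ_X_mul, coeff_derivative, coeff_smul, coeff_X_pow]
      split_ifs with h
      · rw [← h]; push_cast; simp
      · simp
  unfold HasLogDeriv lambertTerm
  rw [map_sub, mul_sub, h, ← Nat.cast_one, Derivation.map_natCast, mul_zero, zero_sub, Nat.cast_one,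
    neg_smul, mul_neg, mul_smul_comm]
  congr 2
  linear_combination (-X ^ k : ℚ⟦X⟧) * one_sub_X_pow_mul_geomSeries hk

theorem hasLogDeriv_geomSeries {k : ℕ} (hk : 0 < k) :
    HasLogDeriv (geomSeries k) ((k : ℚ) • lambertTerm k) := by
  have h := one_sub_X_pow_mul_geomSeries hk
  have h1 := hasLogDeriv_one_sub_X_pow hk
  have h2 := congrArg (d⁄dX ℚ) h
  unfold HasLogDeriv at *
  rw [Derivation.leibniz, smul_eq_mul, smul_eq_mul, ← Nat.cast_one (R := ℚ⟦X⟧),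
    Derivation.map_natCast, Nat.cast_one] at h2
  rw [neg_smul] at h1
  set D := d⁄dX ℚ (geomSeries k)
  set E := d⁄dX ℚ (1 - X ^ k)
  set G := geomSeries k
  set l := (k : ℚ) • lambertTerm k
  linear_combination (X * G) * h2 - G ^ 2 * h1 - (X * D - G * l) * h

/-- If `P` agrees with `F` modulo `X ^ (n + 1)`, then the logarithmic derivative of `P` may serve
as that of `F` in degree `n`. -/
theorem coeff_mul_of_hasLogDeriv {F P G L : ℚ⟦X⟧} {n : ℕ} (hF : F = P + X ^ (n + 1) * G)
    (hP : HasLogDeriv P L) : coeff n (F * L) = n * coeff n F := by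
  have h0 : ∀ H : ℚ⟦X⟧, coeff n (X ^ (n + 1) * H) = 0 := fun H => by
    rw [coeff_X_pow_mul', if_neg (by omega)]
  have h1 : coeff n (X * d⁄dX ℚ P) = n * coeff n P := by
    cases n with
    | zero => simp
    | succ m => rw [coeff_succ_X_mul, coeff_derivative]; push_cast; ring
  rw [hF, add_mul, mul_assoc, map_add, map_add, h0, h0, ← hP, h1, add_zero, add_zero]

/-- The sum of the divisors `d` of `n` whose codivisor `n / d` is odd. -/
def sumOddCodivisor (n : ℕ) : ℚ := ∑ d ∈ n.divisors with Odd (n / d), (d : ℚ)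

/-- The sum of the divisors of `n`, the even ones counted negatively. -/
def altDivisorSum (n : ℕ) : ℚ := ∑ d ∈ n.divisors, -(-1) ^ d * (d : ℚ)

/-- Summing series whose coefficient at `m` is `a k` when `k ∣ m` and `0` otherwise gives a divisor
sum; the summands beyond `m` do not contribute. -/
theorem coeff_sum_eq_sum_divisors {g : ℕ → ℚ⟦X⟧} {a : ℕ → ℚ} {m n : ℕ} (hmn : m ≤ n)
    (hg : ∀ k, 0 < k → coeff m (g k) = if k ≤ m ∧ k ∣ m then a k else 0) :
    coeff m (∑ r ∈ Finset.range n, g (r + 1)) = ∑ d ∈ m.divisors, a d := by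
  rw [map_sum, Nat.divisors, Finset.sum_filter, Finset.sum_Ico_eq_sum_range, Nat.add_sub_cancel]
  have : ∀ r, coeff m (g (r + 1)) =
      if r < m then (if r + 1 ∣ m then a (r + 1) else 0) else 0 := by
    intro r
    rw [hg _ r.succ_pos]
    by_cases h1 : r < m <;> by_cases h2 : r + 1 ∣ m <;> simp [h1, h2]
  simp only [this]
  rw [← Finset.sum_filter, show (Finset.range n).filter (· < m) = Finset.range m by
    ext; simp; omega]
  simp [add_comm]

/-! ### Recurrences for divisor sums -/

theorem coeff_sum_X_pow_mul {ι : Type*} (s : Finset ι) (c : ι → ℚ) (k : ι → ℕ) (L : ℚ⟦X⟧)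
    (N : ℕ) : coeff N ((∑ e ∈ s, c e • X ^ k e) * L) =
      ∑ e ∈ s, c e * if k e ≤ N then coeff (N - k e) L else 0 := by
  simp only [Finset.sum_mul, map_sum, smul_mul_assoc, coeff_smul, coeff_X_pow_mul', smul_eq_mul]

theorem sum_Icc_neg_natAbs {M : Type*} [AddCommMonoid M] (f : ℕ → M) (n : ℕ) :
    ∑ e ∈ Finset.Icc (-(n : ℤ)) n, f e.natAbs = f 0 + 2 • ∑ s ∈ Finset.range n, f (s + 1) := by
  induction n with
  | zero => simp
  | succ n ih =>
    have : Finset.Icc (-((n + 1 : ℕ) : ℤ)) (n + 1 : ℕ) =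
        insert (-((n + 1 : ℕ) : ℤ)) (insert ((n + 1 : ℕ) : ℤ) (Finset.Icc (-(n : ℤ)) n)) := by
      ext e; simp only [Finset.mem_Icc, Finset.mem_insert]; omega
    rw [this, Finset.sum_insert (by simp; omega), Finset.sum_insert (by simp), ih,
      Finset.sum_range_succ, Int.natAbs_neg, Int.natAbs_natCast]
    abel

/-- The recurrence for `sumOddCodivisor`, at non-squares. Arguments `N - e ^ 2 < 0` contribute
zero, as `sumOddCodivisor 0 = 0`. -/
theorem sum_sumOddCodivisor_sub_sq {N : ℕ} (hN : ¬ IsSquare N) :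
    ∑ e ∈ Finset.Icc (-(N : ℤ)) N,
      (-1) ^ e.natAbs * sumOddCodivisor ((N : ℤ) - e ^ 2).toNat = 0 := by
  -- `i r` is the inverse of `1 + X ^ r`; for `0 < r` it is written so that its logarithmic
  -- derivative can be read off.
  let i : ℕ → ℚ⟦X⟧ := fun r => if r = 0 then C (1 / 2) else (1 - X ^ r) * geomSeries (2 * r)
  have hi : ∀ r, (1 + X ^ r) * i r = 1 := by
    intro r
    rcases Nat.eq_zero_or_pos r with rfl | hr
    · simp only [i, if_true, pow_zero]
      rw [← map_one C, ← map_add, ← map_mul]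
      norm_num
    · simp only [i, hr.ne', if_false]
      have := one_sub_X_pow_mul_geomSeries (k := 2 * r) (by omega)
      rw [mul_comm 2 r, pow_mul] at this
      rw [mul_comm 2 r]
      linear_combination this
  let g : ℕ → ℚ⟦X⟧ := fun k => -(k : ℚ) • lambertTerm k +
    (-(k : ℚ) • lambertTerm k + ((2 * k : ℕ) : ℚ) • lambertTerm (2 * k))
  have hP : HasLogDeriv (∏ r ∈ Finset.Ico 0 N, (1 - X ^ (r + 1)) * i (r + 1))
      (∑ r ∈ Finset.range N, g (r + 1)) := by
    refine HasLogDeriv.prod N fun r => (hasLogDeriv_one_sub_X_pow r.succ_pos).mul ?_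
    simp only [i, r.succ_ne_zero, if_false]
    exact (hasLogDeriv_one_sub_X_pow r.succ_pos).mul (hasLogDeriv_geomSeries (by omega))
  have hL : ∀ m ≤ N, coeff m (∑ r ∈ Finset.range N, g (r + 1)) = -2 * sumOddCodivisor m := by
    intro m hm
    rw [coeff_sum_eq_sum_divisors (a := fun k => if Odd (m / k) then -2 * (k : ℚ) else 0) hm]
    · rw [sumOddCodivisor, Finset.mul_sum, Finset.sum_filter]
    · intro k hk
      simp only [g, map_add, coeff_smul, coeff_lambertTerm, smul_eq_mul]
      by_cases h : k ≤ m ∧ k ∣ m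
      · obtain ⟨hkm, j, rfl⟩ := h
        rw [Nat.mul_div_cancel_left _ hk]
        have hj : 0 < j := Nat.pos_of_ne_zero fun h => by simp [h] at hkm; omega
        -- The term of `2 * k` cancels the two terms of `k` exactly when the codivisor `j` is even.
        rcases Nat.even_or_odd j with ho | ho
        · obtain ⟨t, rfl⟩ := ho.two_dvd
          have h1 : 2 * k ≤ k * (2 * t) := by
            rw [mul_comm 2 k]
            exact Nat.mul_le_mul_left k (by omega)
          have h2 : 2 * k ∣ k * (2 * t) := ⟨t, by ring⟩
          simp only [hkm, h1, h2, dvd_mul_right, and_self, if_true, Nat.not_odd_iff_even.2 ho,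
            if_false]
          push_cast
          ring
        · have h2 : ¬ 2 * k ∣ k * j := by
            rw [mul_comm 2 k, Nat.mul_dvd_mul_iff_left hk]
            exact fun h => (Nat.not_even_iff_odd.2 ho) (even_iff_two_dvd.2 h)
          simp [hkm, h2, ho]
          ring
      · have h2 : ¬ (2 * k ≤ m ∧ 2 * k ∣ m) := fun h' =>
          h ⟨by omega, (Dvd.intro_left 2 rfl).trans h'.2⟩
        simp only [h, h2, if_false, mul_zero, add_zero]
  have hF := gauss_square_finite (X : ℚ⟦X⟧) i hi N
  set F : ℚ⟦X⟧ :=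
    ∑ e ∈ Finset.Icc (-(N : ℤ)) N, ((-1) ^ e.natAbs : ℚ) • X ^ (e.natAbs ^ 2) with hFdef
  have hFs : F = 1 + 2 * ∑ s ∈ Finset.range N, (-1) ^ (s + 1) * X ^ ((s + 1) ^ 2) := by
    rw [hFdef, sum_Icc_neg_natAbs (fun k => ((-1) ^ k : ℚ) • (X : ℚ⟦X⟧) ^ (k ^ 2)), nsmul_eq_mul]
    congr 1
    · simp
    · congr 1
      refine Finset.sum_congr rfl fun s _ => ?_
      rw [smul_eq_C_mul, map_pow, map_neg, map_one]
  rw [Finset.sum_range_succ', ← hFs] at hF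
  have hF' : ∃ G, F = (∏ r ∈ Finset.Ico 0 N, (1 - X ^ (r + 1)) * i (r + 1)) + X ^ (N + 1) * G := by
    refine ⟨∑ s ∈ Finset.range N, 2 * i (s + 1) * (-1) ^ (s + 1) * X ^ (s * (N + 1)) *
          ∏ r ∈ Finset.Ico (s + 1) N, (1 - X ^ (r + 1)) * i (r + 1), ?_⟩
    rw [hF, add_comm, Finset.mul_sum]
    congr 1
    · have := hi 0
      simp only [pow_zero, zero_mul, mul_one] at this ⊢
      linear_combination (∏ r ∈ Finset.Ico 0 N, (1 - X ^ (r + 1)) * i (r + 1)) * this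
    · refine Finset.sum_congr rfl fun s _ => ?_
      rw [add_mul s 1, one_mul, pow_add]
      ring
  obtain ⟨G, hG⟩ := hF'
  have key := coeff_mul_of_hasLogDeriv hG hP
  have hzero : coeff N F = 0 := by
    rw [hFdef, map_sum]
    refine Finset.sum_eq_zero fun e _ => ?_
    rw [coeff_smul, coeff_X_pow, if_neg, smul_zero]
    rintro rfl
    exact hN ⟨e.natAbs, sq _⟩
  rw [hzero, mul_zero, hFdef, coeff_sum_X_pow_mul] at key
  rw [← mul_right_inj' (show (-2 : ℚ) ≠ 0 by norm_num), mul_zero, ← key, Finset.mul_sum]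
  refine Finset.sum_congr rfl fun e _ => ?_
  have hsq : e ^ 2 = (e.natAbs ^ 2 : ℕ) := by simp
  split_ifs with h
  · rw [hL _ (Nat.sub_le _ _), show ((N : ℤ) - e ^ 2).toNat = N - e.natAbs ^ 2 by
      rw [hsq]; omega]
    ring
  · rw [show ((N : ℤ) - e ^ 2).toNat = 0 by
      rw [hsq]; omega]
    simp [sumOddCodivisor]

theorem sum_Ico_neg_triangular {M : Type*} [AddCommMonoid M] (f : ℕ → M) (n : ℕ) :
    ∑ j ∈ Finset.Ico (-(n : ℤ)) n, f (j * (j + 1) / 2).toNat =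
      2 • ∑ s ∈ Finset.range n, f (s * (s + 1) / 2) := by
  induction n with
  | zero => simp
  | succ n ih =>
    have : Finset.Ico (-((n + 1 : ℕ) : ℤ)) (n + 1 : ℕ) =
        insert (-((n + 1 : ℕ) : ℤ)) (insert (n : ℤ) (Finset.Ico (-(n : ℤ)) n)) := by
      ext e; simp only [Finset.mem_Ico, Finset.mem_insert]; omega
    have h1 : ((n : ℤ) * (n + 1) / 2).toNat = n * (n + 1) / 2 := by norm_cast
    have h2 : -((n + 1 : ℕ) : ℤ) * (-((n + 1 : ℕ) : ℤ) + 1) = n * (n + 1) := by push_cast; ring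
    rw [this, Finset.sum_insert (by simp), Finset.sum_insert (by simp), ih,
      Finset.sum_range_succ, h2, h1]
    abel

/-- The recurrence for `altDivisorSum`, at non-triangular numbers. The range contains `j` and
`-1 - j` together, so every triangular number it reaches occurs twice. -/
theorem sum_altDivisorSum_sub_triangular {N : ℕ} (hN : ∀ s, s * (s + 1) / 2 ≠ N) :
    ∑ j ∈ Finset.Ico (-((2 * N : ℕ) : ℤ)) (2 * N : ℕ),
      altDivisorSum ((N : ℤ) - j * (j + 1) / 2).toNat = 0 := by
  have hi : ∀ r, (1 - X ^ (2 * r + 1)) * geomSeries (2 * r + 1) = 1 := fun r =>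
    one_sub_X_pow_mul_geomSeries (by omega)
  let g : ℕ → ℚ⟦X⟧ := fun k => (-(-1) ^ k * (k : ℚ)) • lambertTerm k
  have hP : HasLogDeriv (∏ r ∈ Finset.Ico 0 N, (1 - X ^ (2 * r + 2)) * geomSeries (2 * r + 1))
      (∑ r ∈ Finset.range (2 * N), g (r + 1)) := by
    -- The factors `2 * r + 1` and `2 * r + 2` of the product are paired.
    have hg : ∀ n, ∑ r ∈ Finset.range (2 * n), g (r + 1) = ∑ r ∈ Finset.range n,
        (-((2 * r + 2 : ℕ) : ℚ) • lambertTerm (2 * r + 2) +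
          ((2 * r + 1 : ℕ) : ℚ) • lambertTerm (2 * r + 1)) := by
      intro n
      induction n with
      | zero => simp
      | succ n ih =>
        rw [show 2 * (n + 1) = 2 * n + 1 + 1 by ring, Finset.sum_range_succ, Finset.sum_range_succ,
          Finset.sum_range_succ, ih, add_assoc, add_comm (g _)]
        simp only [g]
        congr 3
        · rw [Even.neg_one_pow ⟨n + 1, by ring⟩, neg_one_mul]
        · rw [Odd.neg_one_pow ⟨n, rfl⟩, neg_neg, one_mul]
    rw [hg]
    exact HasLogDeriv.prod N fun r => (hasLogDeriv_one_sub_X_pow (by omega)).mul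
      (hasLogDeriv_geomSeries (by omega))
  have hL : ∀ m ≤ N, coeff m (∑ r ∈ Finset.range (2 * N), g (r + 1)) = altDivisorSum m := by
    intro m hm
    rw [coeff_sum_eq_sum_divisors (a := fun k => -(-1) ^ k * (k : ℚ)) (by omega), altDivisorSum]
    intro k _
    rw [coeff_smul, coeff_lambertTerm, smul_eq_mul, mul_ite, mul_one, mul_zero]
  have hF := gauss_triangular_finite (X : ℚ⟦X⟧) (fun r => geomSeries (2 * r + 1)) hi N
  set F : ℚ⟦X⟧ := ∑ s ∈ Finset.range (2 * N), (1 : ℚ) • X ^ (s * (s + 1) / 2) with hFdef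
  have hF' : ∃ G, F = (∏ r ∈ Finset.Ico 0 N, (1 - X ^ (2 * r + 2)) * geomSeries (2 * r + 1)) +
      X ^ (N + 1) * G := by
    obtain _ | n := N
    · exact absurd rfl (hN 0)
    refine ⟨X ^ (n + 1) * ∑ s ∈ Finset.range n, X ^ (s * (2 * (n + 1) + 1)) *
          ∏ r ∈ Finset.Ico (s + 1) (n + 1), (1 - X ^ (2 * r + 2)) * geomSeries (2 * r + 1), ?_⟩
    simp only [hFdef, one_smul]
    rw [hF, Finset.sum_range_succ', zero_mul, pow_zero, mul_one, add_comm, Finset.mul_sum,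
      Finset.mul_sum]
    congr 1
    refine Finset.sum_congr rfl fun s _ => ?_
    rw [add_mul s 1, one_mul, pow_add, show 2 * (n + 1) + 1 = n + 1 + 1 + (n + 1) by ring,
      pow_add _ (n + 1 + 1)]
    ring
  obtain ⟨G, hG⟩ := hF'
  have key := coeff_mul_of_hasLogDeriv hG hP
  have hzero : coeff N F = 0 := by
    rw [hFdef, map_sum]
    refine Finset.sum_eq_zero fun s _ => ?_
    rw [coeff_smul, coeff_X_pow, if_neg (hN s).symm, smul_zero]
  rw [hzero, mul_zero, hFdef, coeff_sum_X_pow_mul] at key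
  have h2 := sum_Ico_neg_triangular (fun t => altDivisorSum (N - t)) (2 * N)
  have h3 : ∀ j : ℤ, ((N : ℤ) - j * (j + 1) / 2).toNat = N - (j * (j + 1) / 2).toNat := by
    intro j
    have : 0 ≤ j * (j + 1) := by
      rcases le_or_gt 0 j with h | h <;> nlinarith
    generalize j * (j + 1) = t at *
    omega
  simp only [h3]
  rw [h2, ← smul_zero (2 : ℕ), ← key]
  congr 1
  refine Finset.sum_congr rfl fun s _ => ?_
  split_ifs with h
  · rw [hL _ (Nat.sub_le _ _), one_mul]
  · rw [Nat.sub_eq_zero_of_le (by omega)]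
    simp [altDivisorSum]

end PowerSeries

/-! ### Divisor sums at `k`, `k / 2` and `k / 4` -/

/-- The divisor sum `σ₁` at `n` with rational values. -/
def sumDivisors (n : ℕ) : ℚ := ∑ d ∈ n.divisors, (d : ℚ)

theorem sigmaOne_natCast {n : ℕ} (hn : 0 < n) : sigmaOne n = sumDivisors n := by
  simp [sigmaOne, hn, ArithmeticFunction.sigma_one_apply, sumDivisors]

theorem sigmaOne_of_neg {n : ℤ} (hn : n < 0) : sigmaOne n = 0 := by
  rw [sigmaOne, if_neg (by omega), if_neg (by omega)]

/-- The divisors of `2 * m` with even codivisor are the divisors of `m`. -/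
theorem sumDivisors_two_mul (m : ℕ) :
    sumDivisors (2 * m) = sumOddCodivisor (2 * m) + sumDivisors m := by
  rcases Nat.eq_zero_or_pos m with rfl | hm
  · simp [sumDivisors, sumOddCodivisor]
  rw [sumDivisors, sumOddCodivisor, sumDivisors,
    ← Finset.sum_filter_add_sum_filter_not _ (fun d => Odd (2 * m / d))]
  congr 2
  ext d
  simp only [Finset.mem_filter, Nat.mem_divisors, Nat.not_odd_iff_even]
  constructor
  · rintro ⟨⟨⟨c, hc⟩, -⟩, he⟩
    have hd : 0 < d := Nat.pos_of_ne_zero fun h => by simp [h] at hc; omega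
    rw [hc, Nat.mul_div_cancel_left _ hd] at he
    obtain ⟨t, rfl⟩ := he.two_dvd
    exact ⟨⟨t, by nlinarith⟩, hm.ne'⟩
  · rintro ⟨⟨c, rfl⟩, -⟩
    have hd : 0 < d := Nat.pos_of_mul_pos_right hm
    refine ⟨⟨⟨2 * c, by ring⟩, by omega⟩, ?_⟩
    rw [show 2 * (d * c) = d * (2 * c) by ring, Nat.mul_div_cancel_left _ hd]
    exact even_two_mul c

/-- The divisors of `2 * m` with odd codivisor are the doubles of those of `m`. -/
theorem sumOddCodivisor_two_mul (m : ℕ) :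
    sumOddCodivisor (2 * m) = 2 * sumOddCodivisor m := by
  rcases Nat.eq_zero_or_pos m with rfl | hm
  · simp [sumOddCodivisor]
  rw [sumOddCodivisor, sumOddCodivisor, Finset.mul_sum]
  symm
  refine Finset.sum_nbij (fun d => 2 * d) ?_ (fun a _ b _ h => by simpa using h) ?_
    (fun a _ => by push_cast; rfl)
  · intro d hd
    simp only [Finset.mem_filter, Nat.mem_divisors] at hd ⊢
    rw [Nat.mul_div_mul_left _ _ two_pos]
    exact ⟨⟨Nat.mul_dvd_mul_left 2 hd.1.1, by omega⟩, hd.2⟩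
  · intro d hd
    simp only [Finset.coe_filter, Set.mem_ofPred_eq, Nat.mem_divisors] at hd
    obtain ⟨⟨⟨c, hc⟩, -⟩, ho⟩ := hd
    have hd : 0 < d := Nat.pos_of_ne_zero fun h => by simp [h] at hc; omega
    rw [hc, Nat.mul_div_cancel_left _ hd] at ho
    have he : Even d := by
      have : Even (d * c) := hc ▸ even_two_mul m
      exact (Nat.even_mul.1 this).resolve_right (Nat.not_even_iff_odd.2 ho)
    obtain ⟨t, rfl⟩ := he.two_dvd
    have ht : m = t * c := by nlinarith
    refine ⟨t, ?_, rfl⟩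
    simp only [Finset.coe_filter, Set.mem_ofPred_eq, Nat.mem_divisors]
    refine ⟨⟨⟨c, ht⟩, hm.ne'⟩, ?_⟩
    rwa [ht, Nat.mul_div_cancel_left _ (by omega)]

theorem sumDivisors_of_odd {m : ℕ} (hm : Odd m) : sumDivisors m = sumOddCodivisor m := by
  rw [sumDivisors, sumOddCodivisor, Finset.filter_true_of_mem]
  intro d hd
  exact hm.of_dvd_nat (Nat.div_dvd_of_dvd (Nat.mem_divisors.1 hd).1)

theorem altDivisorSum_of_odd {m : ℕ} (hm : Odd m) : altDivisorSum m = sumDivisors m := by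
  refine Finset.sum_congr rfl fun d hd => ?_
  rw [(hm.of_dvd_nat (Nat.mem_divisors.1 hd).1).neg_one_pow, neg_neg, one_mul]

theorem altDivisorSum_two_mul (m : ℕ) :
    altDivisorSum (2 * m) = sumDivisors (2 * m) - 4 * sumDivisors m := by
  rcases Nat.eq_zero_or_pos m with rfl | hm
  · simp [sumDivisors, altDivisorSum]
  have h : ∑ d ∈ (2 * m).divisors with Even d, (d : ℚ) = 2 * sumDivisors m := by
    rw [sumDivisors, Finset.mul_sum]
    symm
    refine Finset.sum_nbij (fun d => 2 * d) ?_ (fun a _ b _ h => by simpa using h) ?_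
      (fun a _ => by push_cast; rfl)
    · intro d hd
      simp only [Finset.mem_filter, Nat.mem_divisors] at hd ⊢
      exact ⟨⟨Nat.mul_dvd_mul_left 2 hd.1, by omega⟩, even_two_mul d⟩
    · intro d hd
      simp only [Finset.coe_filter, Set.mem_ofPred_eq, Nat.mem_divisors] at hd
      obtain ⟨⟨hd, -⟩, he⟩ := hd
      obtain ⟨t, rfl⟩ := he.two_dvd
      exact ⟨t, by simpa using ⟨(Nat.mul_dvd_mul_iff_left two_pos).1 hd, hm.ne'⟩, rfl⟩
  rw [show 4 * sumDivisors m = 2 * (2 * sumDivisors m) by ring, ← h, Finset.sum_filter,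
    altDivisorSum, sumDivisors, Finset.mul_sum, ← Finset.sum_sub_distrib]
  refine Finset.sum_congr rfl fun d _ => ?_
  split_ifs with he
  · rw [he.neg_one_pow]; ring
  · rw [(Nat.not_even_iff_odd.1 he).neg_one_pow]; ring

/-- The summandwise form of the identity for even discriminants: terms with non-integral argument
count as zero. -/
theorem sigmaOne_combination {k : ℤ} (hk : k ≠ 0) :
    5 * (if 2 ∣ k then sigmaOne (k / 2) else 0) - sigmaOne k -
      4 * (if 4 ∣ k then sigmaOne (k / 4) else 0) = (-1) ^ k.natAbs * sumOddCodivisor k.toNat := by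
  rcases hk.lt_or_gt with h | h
  · rw [sigmaOne_of_neg h, sigmaOne_of_neg (n := k / 2) (by omega),
      sigmaOne_of_neg (n := k / 4) (by omega), show k.toNat = 0 by omega]
    simp [sumOddCodivisor]
  lift k to ℕ using h.le
  have hk' : 0 < k := by omega
  simp only [Int.toNat_natCast, Int.natAbs_natCast]
  rcases Nat.even_or_odd k with he | ho
  · obtain ⟨m, rfl⟩ := he.two_dvd
    rw [(even_two_mul m).neg_one_pow, if_pos (by push_cast; exact dvd_mul_right _ _),
      sigmaOne_natCast hk', show ((2 * m : ℕ) : ℤ) / 2 = m by omega,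
      sigmaOne_natCast (by omega : 0 < m), sumDivisors_two_mul, sumOddCodivisor_two_mul]
    rcases Nat.even_or_odd m with he | ho
    · obtain ⟨t, rfl⟩ := he.two_dvd
      rw [if_pos (by omega), show ((2 * (2 * t) : ℕ) : ℤ) / 4 = t by omega,
        sigmaOne_natCast (by omega : 0 < t), sumDivisors_two_mul]
      ring
    · rw [if_neg (by obtain ⟨t, rfl⟩ := ho; omega), sumDivisors_of_odd ho]
      ring
  · rw [ho.neg_one_pow, if_neg (by obtain ⟨t, rfl⟩ := ho; omega),
      if_neg (by obtain ⟨t, rfl⟩ := ho; omega), sigmaOne_natCast hk', sumDivisors_of_odd ho]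
    ring

/-- The summandwise form of the identity for odd discriminants. -/
theorem sigmaOne_sub_sigmaOne_two_mul {k : ℤ} (hk : k ≠ 0) :
    2 * sigmaOne (2 * k) - 5 * sigmaOne k = altDivisorSum k.toNat := by
  rcases hk.lt_or_gt with h | h
  · rw [sigmaOne_of_neg h, sigmaOne_of_neg (n := 2 * k) (by omega), show k.toNat = 0 by omega]
    simp [altDivisorSum]
  lift k to ℕ using h.le
  have hk' : 0 < k := by omega
  rw [Int.toNat_natCast, sigmaOne_natCast hk',
    show (2 : ℤ) * k = ((2 * k : ℕ) : ℤ) by push_cast; rfl,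
    sigmaOne_natCast (by omega), sumDivisors_two_mul, sumOddCodivisor_two_mul]
  rcases Nat.even_or_odd k with he | ho
  · obtain ⟨m, rfl⟩ := he.two_dvd
    rw [altDivisorSum_two_mul, sumDivisors_two_mul, sumOddCodivisor_two_mul]
    ring
  · rw [altDivisorSum_of_odd ho, sumDivisors_of_odd ho]
    ring

/-! ### Sums over all integers -/

/-- A sum over the integers `e` with `p e` becomes a finite sum along an injective
parametrization `g` of an over-set of them. -/
theorem finsum_eq_sum_of_injective {p : ℤ → Prop} [DecidablePred p] {f : ℤ → ℚ} {g : ℤ → ℤ}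
    (hg : Function.Injective g) (hp : ∀ e, p e → e ∈ Set.range g) (s : Finset ℤ)
    (hs : ∀ j, j ∉ s → f (g j) = 0) :
    ∑ᶠ (e : ℤ) (_ : p e), f e = ∑ j ∈ s, if p (g j) then f (g j) else 0 := by
  have h1 : ∀ e, ∑ᶠ (_ : p e), f e = if p e then f e else 0 := fun e => finsum_eq_if
  simp only [h1]
  have h2 : ∑ᶠ e ∈ Set.range g, (if p e then f e else 0) = ∑ᶠ e, if p e then f e else 0 := by
    refine finsum_congr fun e => ?_
    by_cases he : e ∈ Set.range g
    · simp only [he, finsum_true]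
    · rw [if_neg fun h => he (hp e h), finsum_zero]
  rw [← h2, finsum_mem_range hg]
  refine finsum_eq_sum_of_support_subset _ fun j hj => ?_
  by_contra hjs
  exact hj (by simp [hs j hjs])

theorem theorem2p1 (D : ℕ) (hD : ¬ IsSquare D) :
    (D ≡ 0 [MOD 4] →
      (∑ᶠ (e : ℤ) (_ : e ^ 2 ≡ (D : ℤ) [ZMOD 8]), sigmaOne (((D : ℤ) - e ^ 2) / 8)) =
        (1 / 5 : ℚ) *
          (∑ᶠ (e : ℤ) (_ : Even e), sigmaOne (((D : ℤ) - e ^ 2) / 4)) +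
        (4 / 5 : ℚ) *
          (∑ᶠ (e : ℤ) (_ : e ^ 2 ≡ (D : ℤ) / 4 [ZMOD 4]),
            sigmaOne (((D : ℤ) / 4 - e ^ 2) / 4))) ∧
    (D ≡ 1 [MOD 8] →
      (∑ᶠ (e : ℤ) (_ : Odd e), sigmaOne (((D : ℤ) - e ^ 2) / 8)) =
        (2 / 5 : ℚ) *
          (∑ᶠ (e : ℤ) (_ : Odd e), sigmaOne (((D : ℤ) - e ^ 2) / 4))) := by
  have hinj2 : Function.Injective fun e : ℤ => 2 * e := fun a b h => by simpa using h
  have hinj2' : Function.Injective fun e : ℤ => 2 * e + 1 := fun a b h => by simpa using h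
  constructor
  · intro h4
    obtain ⟨N, rfl⟩ := (Nat.modEq_zero_iff_dvd).1 h4
    have hN : ¬ IsSquare N := by
      rintro ⟨r, rfl⟩
      exact hD ⟨2 * r, by ring⟩
    have hneg : ∀ e ∉ Finset.Icc (-(N : ℤ)) N, (N : ℤ) - e ^ 2 < 0 := by
      intro e he
      rw [Finset.mem_Icc, ← abs_le, not_le] at he
      rw [← sq_abs]
      nlinarith [Int.natCast_nonneg N]
    have hq : ((4 * N : ℕ) : ℤ) / 4 = N := by omega
    have hsq : ∀ e : ℤ, (2 * e) ^ 2 = 4 * e ^ 2 := fun e => by ring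
    rw [finsum_eq_sum_of_injective (p := fun e => e ^ 2 ≡ ((4 * N : ℕ) : ℤ) [ZMOD 8]) hinj2 _
        (Finset.Icc (-(N : ℤ)) N),
      finsum_eq_sum_of_injective (p := fun e => Even e) hinj2 _ (Finset.Icc (-(N : ℤ)) N),
      finsum_eq_sum_of_injective (p := fun e => e ^ 2 ≡ ((4 * N : ℕ) : ℤ) / 4 [ZMOD 4])
        Function.injective_id (by simp) (Finset.Icc (-(N : ℤ)) N)]
    · have key := sum_sumOddCodivisor_sub_sq hN
      have hterm : ∀ e : ℤ, (-1 : ℚ) ^ N * ((-1) ^ e.natAbs *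
            sumOddCodivisor ((N : ℤ) - e ^ 2).toNat) =
          5 * (if (2 * e) ^ 2 ≡ ((4 * N : ℕ) : ℤ) [ZMOD 8] then
              sigmaOne ((((4 * N : ℕ) : ℤ) - (2 * e) ^ 2) / 8) else 0) -
            (if Even (2 * e) then sigmaOne ((((4 * N : ℕ) : ℤ) - (2 * e) ^ 2) / 4) else 0) -
            4 * (if (id e) ^ 2 ≡ ((4 * N : ℕ) : ℤ) / 4 [ZMOD 4] then
              sigmaOne ((((4 * N : ℕ) : ℤ) / 4 - (id e) ^ 2) / 4) else 0) := by
        intro e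
        have hk : (N : ℤ) - e ^ 2 ≠ 0 := by
          intro h
          refine hN ⟨e.natAbs, ?_⟩
          zify
          rw [← sq, sq_abs]
          linarith
        -- `e` and `e ^ 2` have the same parity, so the sign at `e` is that of `N - e ^ 2` up to
        -- the constant `(-1) ^ N`.
        have hsign : (-1 : ℚ) ^ N * (-1) ^ e.natAbs = (-1) ^ ((N : ℤ) - e ^ 2).natAbs := by
          rw [← pow_add]
          refine neg_one_pow_congr ?_
          rw [Int.natAbs_even, Nat.even_add, Int.even_sub, Int.even_pow' two_ne_zero,
            Int.natAbs_even, Int.even_coe_nat]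
        rw [← mul_assoc, hsign, ← sigmaOne_combination hk, hq, hsq, if_pos (even_two_mul e), id]
        simp only [Int.modEq_iff_dvd]
        have e1 : (((4 * N : ℕ) : ℤ) - 4 * e ^ 2) / 8 = ((N : ℤ) - e ^ 2) / 2 := by omega
        have e2 : (((4 * N : ℕ) : ℤ) - 4 * e ^ 2) / 4 = (N : ℤ) - e ^ 2 := by omega
        have e3 : (8 : ℤ) ∣ ((4 * N : ℕ) : ℤ) - 4 * e ^ 2 ↔ 2 ∣ (N : ℤ) - e ^ 2 := by omega
        simp only [e1, e2, e3]
      have hsum := congrArg (fun t => (-1 : ℚ) ^ N * t) key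
      simp only [mul_zero, Finset.mul_sum] at hsum
      rw [Finset.sum_congr rfl fun e _ => hterm e, Finset.sum_sub_distrib, Finset.sum_sub_distrib,
        ← Finset.mul_sum, ← Finset.mul_sum] at hsum
      linear_combination (1 / 5 : ℚ) * hsum
    · intro e he
      have := hneg e he
      exact sigmaOne_of_neg (by rw [hq, id]; omega)
    · intro e he
      have := hneg e he
      exact sigmaOne_of_neg (by rw [hsq]; omega)
    · rintro e ⟨r, rfl⟩
      exact ⟨r, by ring⟩
    · intro e he
      have := hneg e he
      exact sigmaOne_of_neg (by rw [hsq]; omega)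
    · intro e he
      rcases Int.even_or_odd e with h | ⟨r, rfl⟩
      · obtain ⟨r, rfl⟩ := h
        exact ⟨r, by ring⟩
      · have h2 := (Int.modEq_iff_dvd).1 he
        rw [show (2 * r + 1) ^ 2 = 4 * (r ^ 2 + r) + 1 by ring] at h2
        omega
  · intro h8
    obtain ⟨N, rfl⟩ : ∃ N, D = 8 * N + 1 := ⟨D / 8, by have : D % 8 = 1 := h8; omega⟩
    have hN : ∀ s, s * (s + 1) / 2 ≠ N := by
      rintro s rfl
      refine hD ⟨2 * s + 1, ?_⟩
      obtain ⟨t, ht⟩ := (Nat.even_mul_succ_self s).two_dvd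
      rw [ht, Nat.mul_div_cancel_left _ two_pos]
      linarith
    have htri : ∀ j : ℤ, ∃ t, j * (j + 1) = 2 * t := fun j => (Int.even_mul_succ_self j).two_dvd
    have hsq : ∀ j : ℤ, ((8 * N + 1 : ℕ) : ℤ) - (2 * j + 1) ^ 2 =
        8 * ((N : ℤ) - j * (j + 1) / 2) := by
      intro j
      obtain ⟨t, ht⟩ := htri j
      rw [ht, Int.mul_ediv_cancel_left _ two_ne_zero]
      push_cast
      linarith
    have hneg : ∀ j ∉ Finset.Ico (-((2 * N : ℕ) : ℤ)) (2 * N : ℕ),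
        (N : ℤ) - j * (j + 1) / 2 < 0 := by
      intro j hj
      obtain ⟨t, ht⟩ := htri j
      rw [ht, Int.mul_ediv_cancel_left _ two_ne_zero]
      -- `0` is triangular, and for `1 ≤ N` the triangular number of index `2 * N` exceeds `N`.
      have hN0 : N ≠ 0 := fun h => hN 0 (by simp [h])
      rw [Finset.mem_Ico, not_and_or, not_le, not_lt] at hj
      push_cast at hj
      rcases hj with h | h <;> nlinarith [Int.natCast_nonneg N, (by omega : (1 : ℤ) ≤ N)]
    rw [finsum_eq_sum_of_injective (p := fun e => Odd e) hinj2' _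
        (Finset.Ico (-((2 * N : ℕ) : ℤ)) (2 * N : ℕ)),
      finsum_eq_sum_of_injective (p := fun e => Odd e) hinj2' _
        (Finset.Ico (-((2 * N : ℕ) : ℤ)) (2 * N : ℕ))]
    · have key := sum_altDivisorSum_sub_triangular hN
      have hterm : ∀ j : ℤ, altDivisorSum ((N : ℤ) - j * (j + 1) / 2).toNat =
          2 * (if Odd (2 * j + 1) then
              sigmaOne ((((8 * N + 1 : ℕ) : ℤ) - (2 * j + 1) ^ 2) / 4) else 0) -
            5 * (if Odd (2 * j + 1) then
              sigmaOne ((((8 * N + 1 : ℕ) : ℤ) - (2 * j + 1) ^ 2) / 8) else 0) := by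
        intro j
        have hk : (N : ℤ) - j * (j + 1) / 2 ≠ 0 := by
          intro h
          refine hD ⟨(2 * j + 1).natAbs, ?_⟩
          have := hsq j
          zify
          rw [← sq, sq_abs]
          push_cast at this
          linarith
        rw [← sigmaOne_sub_sigmaOne_two_mul hk, if_pos (odd_two_mul_add_one j),
          if_pos (odd_two_mul_add_one j), hsq]
        congr 3 <;> omega
      rw [Finset.sum_congr rfl fun e _ => hterm e, Finset.sum_sub_distrib,
        ← Finset.mul_sum, ← Finset.mul_sum] at key
      linear_combination (-1 / 5 : ℚ) * key
    · intro j hj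
      have := hneg j hj
      exact sigmaOne_of_neg (by rw [hsq]; omega)
    · rintro e ⟨r, rfl⟩
      exact ⟨r, rfl⟩
    · intro j hj
      have := hneg j hj
      exact sigmaOne_of_neg (by rw [hsq]; omega)
    · rintro e ⟨r, rfl⟩
      exact ⟨r, rfl⟩
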